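/- All logarithms are to base two, and entropies are in bits. Let $M,q\ge 1$, let $\theta_0,\dots,\theta_{q-1}$ be non-negative integers, and let $p_{S_1},\dots,p_{S_M}$ be probability mass functions on $\{0,\dots,q-1\}$. Then for each $\ell\in\{0,\dots,q-1\}$ there are a number $J$ and a partition of $\{1,\dots,M\}$ into nonempty, pairwise disjoint groups $\mathcal A_1,\dots,\mathcal A_J$, which may be taken to be consecutive intervals (every index in $\mathcal A_m$ is smaller than every index in $\mathcal A_n$ whenever $m<n$), such that the following holds for all independent random variables $S_1,\dots,S_M$ with $S_i\sim p_{S_i}$ and for every $d\in\{0,\dots,J-1\}$. Put $m(d)=((m+d-1)\bmod J)+1$, with the residue taken in $\{0,\dots,J-1\}$, and define $U_0,U_1,\dots,U_J$ by $U_0=0$ and $$U_{m(d)}=U_{m(d)-1}+\sum_{i\in\mathcal A_m}\mathbf 1_{\{U_{m(d)-1}<\theta_\ell\}\cap\{S_i=\ell\}},\qquad m\in\{1,\dots,J\}$$ (so the groups are activated one after the other, group $\mathcal A_m$ in round $m(d)$). Then $$\sum_{m=0}^{J-1}H\bigl(U_{m(d)}\,\big|\,U_{m(d)-1}\bigr)<\frac52\log(1+\theta_\ell)+12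 .$$ In particular the bound does not depend on $M$ or on the distributions. -/

import Mathlib

open MeasureTheory ProbabilityTheory

namespace GroupBroadcast

/-- Shannon entropy `H(X)`, in bits, of a discrete random variable `X` under `P`. It is used below
only for variables with finitely many values, so that the sum has finitely many nonzero terms. -/
noncomputable def entropy {Ω α : Type*} [MeasurableSpace Ω] (P : Measure Ω) (X : Ω → α) : ℝ :=
  ∑' x : α, -(P.real (X ⁻¹' {x}) * Real.logb 2 (P.real (X ⁻¹' {x})))

/-- Conditional Shannon entropy `H(X | Y) = ∑ y, P(Y = y) H(X | Y = y)`, in bits. -/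
noncomputable def condEntropy {Ω α β : Type*} [MeasurableSpace Ω] (P : Measure Ω)
    (X : Ω → α) (Y : Ω → β) : ℝ :=
  ∑' y : β, P.real (Y ⁻¹' {y}) * entropy (ProbabilityTheory.cond P (Y ⁻¹' {y})) X

/-- The sets `A 1, …, A J` form a partition of the set of `M` sensors into nonempty groups.
(The values of `A` outside `1, …, J` play no role.) -/
structure IsGroupPartition {M : ℕ} (J : ℕ) (A : ℕ → Finset (Fin M)) : Prop where
  nonempty : ∀ m ∈ Finset.Icc 1 J, (A m).Nonempty
  cover : ∀ i : Fin M, ∃ m ∈ Finset.Icc 1 J, i ∈ A m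
  disjoint : ∀ m ∈ Finset.Icc 1 J, ∀ n ∈ Finset.Icc 1 J, m ≠ n → Disjoint (A m) (A n)

/-- Each index of an earlier group precedes each index of a later group. For a partition this says
that the groups are consecutive intervals of indices. -/
def IsConsecutive {M : ℕ} (J : ℕ) (A : ℕ → Finset (Fin M)) : Prop :=
  ∀ m ∈ Finset.Icc 1 J, ∀ n ∈ Finset.Icc 1 J, m < n → ∀ i ∈ A m, ∀ j ∈ A n, i < j

/-- `m(d) = ((m + d - 1) mod J) + 1`, the round in which group `m` is active under the cyclic
shift `d`. The `-1` is written as `+ (J - 1)` so that `m = d = 0` gives the value `J`. -/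
def shift (J d m : ℕ) : ℕ := (m + d + (J - 1)) % J + 1

/-- The descriptions `U_0, U_1, …, U_J` of the clipped frequency of the symbol `ℓ` with threshold
`θ` under the cyclic shift `d`: `U_0 = 0`, and in round `k` the active group, which is the group `m`
with `m(d) = k`, adds its indicators of `S_i = ℓ`, provided that `U_{k-1} < θ`. -/
def descr {Ω : Type*} {M q : ℕ} (θ J d : ℕ) (A : ℕ → Finset (Fin M)) (ℓ : Fin q)
    (S : Fin M → Ω → Fin q) : ℕ → Ω → ℕ
  | 0, _ => 0
  | k + 1, ω => descr θ J d A ℓ S k ω +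
      ∑ i ∈ A (shift J (J - d) (k + 1)),
        if descr θ J d A ℓ S k ω < θ ∧ S i ω = ℓ then 1 else 0

/-- The group with index `m(J - d)` computed at `m(d)` is the group `m`. -/
theorem shift_shift {J d m : ℕ} (hd : d < J) (hm : m ∈ Finset.Icc 1 J) :
    shift J (J - d) (shift J d m) = m := by
  rw [Finset.mem_Icc] at hm
  have h : (m + d + (J - 1)) % J + 1 + (J - d) + (J - 1)
      = (m + d + (J - 1)) % J + (1 + (J - d) + (J - 1)) := by omega
  have h2 : m + d + (J - 1) + (1 + (J - d) + (J - 1)) = (m - 1) + J * 3 := by omega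
  unfold shift
  rw [h, Nat.mod_add_mod, h2, Nat.add_mul_mod_self_left, Nat.mod_eq_of_lt (by omega)]
  omega

/-- The defining recursion `U_{m(d)} = U_{m(d)-1} + ∑_{i ∈ A_m} 1{U_{m(d)-1} < θ, S_i = ℓ}`. -/
theorem descr_shift {Ω : Type*} {M q θ J d m : ℕ} (A : ℕ → Finset (Fin M)) (ℓ : Fin q)
    (S : Fin M → Ω → Fin q) (hd : d < J) (hm : m ∈ Finset.Icc 1 J) (ω : Ω) :
    descr θ J d A ℓ S (shift J d m) ω = descr θ J d A ℓ S (shift J d m - 1) ω +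
      ∑ i ∈ A m, if descr θ J d A ℓ S (shift J d m - 1) ω < θ ∧ S i ω = ℓ then 1 else 0 := by
  have h1 : shift J d m = (shift J d m - 1) + 1 := by unfold shift; omega
  have h2 : shift J (J - d) (shift J d m - 1 + 1) = m := by rw [← h1]; exact shift_shift hd hm
  conv_lhs => rw [h1]
  simp only [descr, h2]

/-- The descriptions take only finitely many values. -/
theorem descr_le {Ω : Type*} {M q : ℕ} (θ J d : ℕ) (A : ℕ → Finset (Fin M)) (ℓ : Fin q)
    (S : Fin M → Ω → Fin q) (k : ℕ) (ω : Ω) : descr θ J d A ℓ S k ω ≤ k * M := by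
  induction k with
  | zero => simp [descr]
  | succ k ih =>
    have h : (∑ i ∈ A (shift J (J - d) (k + 1)),
        if descr θ J d A ℓ S k ω < θ ∧ S i ω = ℓ then 1 else 0) ≤ M := by
      calc _ ≤ ∑ i ∈ A (shift J (J - d) (k + 1)), 1 := by
            gcongr; split_ifs <;> simp
        _ ≤ M := by simpa using (A (shift J (J - d) (k + 1))).card_le_univ
    simp only [descr]
    rw [Nat.add_mul, Nat.one_mul]
    omega

end GroupBroadcast

namespace GroupBroadcast

/-! Cut the indices greedily so that each group's expected number of occurrences of `ℓ` is at most
`2θ + 3` and, except for the last group, at least `2θ + 2`. The count `T` of the group active in a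
round is independent of the current `U`, so the round costs at most `P(U < θ) H(T)`
(`condEntropy_add_le`). Comparison with a geometric law bounds `H(T)` by `log (1 + θ) + 7/2`
(`entropy_le`).

By Chernoff, a full group has `T < θ` with probability at most `1/3` (`measure_groupSum_lt_le`), so
`P(U < θ)` shrinks by a factor 3 in every round except the one where the last, possibly short, group
is active. A geometric series plus one exceptional round gives `∑ P(U < θ) ≤ 3/2 + 1 = 5/2`,
wherever the cyclic shift places that round. -/

/-! ### Greedy grouping -/

/-- A sequence with terms in `[0, 1]` can be cut greedily into consecutive nonempty blocks, labelled
`1, …, J` by `g`, such that all block sums are at most `c + 1` and all but the last are at least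
`c`. -/
theorem exists_greedy_blocks (b : ℕ → ℝ) (hb1 : ∀ i, b i ≤ 1) {c : ℝ} (hc : 0 ≤ c)
    (n : ℕ) : ∃ (J : ℕ) (g : ℕ → ℕ),
      (∀ i < n, g i ∈ Finset.Icc 1 J) ∧ (∀ m ∈ Finset.Icc 1 J, ∃ i < n, g i = m) ∧
      (∀ i j, i ≤ j → j < n → g i ≤ g j) ∧
      (∀ m, 1 ≤ m → m < J → c ≤ ∑ i ∈ Finset.range n, if g i = m then b i else 0) ∧
      (∀ m, (∑ i ∈ Finset.range n, if g i = m then b i else 0) ≤ c + 1) := by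
  induction n with
  | zero => exact ⟨0, fun _ => 0, by simp, by simp, by simp, by simp, fun m => by simp; linarith⟩
  | succ n ih =>
    obtain ⟨J, g, hg, hs, hm, hl, hu⟩ := ih
    have key : ∀ v m, (∑ i ∈ Finset.range (n + 1), if Function.update g n v i = m then b i else 0)
        = (∑ i ∈ Finset.range n, if g i = m then b i else 0) + if v = m then b n else 0 := by
      intro v m
      rw [Finset.sum_range_succ, Function.update_self]
      congr 1
      refine Finset.sum_congr rfl fun i hi => ?_
      rw [Function.update_of_ne (by rw [Finset.mem_range] at hi; omega)]
    have upd : ∀ v i, i < n → Function.update g n v i = g i := fun v i hi =>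
      Function.update_of_ne (by omega) _ _
    -- The last block is extended while its sum is below `c`; otherwise a new block is opened. `1 ≤
    -- J` excludes the start, where there is no block to extend.
    by_cases h : 1 ≤ J ∧ (∑ i ∈ Finset.range n, if g i = J then b i else 0) < c
    · refine ⟨J, Function.update g n J, ?_, ?_, ?_, ?_, ?_⟩
      · intro i hi
        rcases Nat.lt_succ_iff_lt_or_eq.1 hi with hi | rfl
        · rw [upd _ _ hi]; exact hg i hi
        · simpa using h.1
      · intro m hmJ
        obtain ⟨i, hi, rfl⟩ := hs m hmJ
        exact ⟨i, by omega, upd _ _ hi⟩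
      · intro i j hij hj
        rcases Nat.lt_succ_iff_lt_or_eq.1 hj with hj | rfl
        · rw [upd _ _ hj, upd _ _ (by omega)]; exact hm i j hij hj
        · rcases hij.lt_or_eq with hij | rfl
          · rw [upd _ _ hij, Function.update_self]
            exact (Finset.mem_Icc.1 (hg i hij)).2
          · exact le_rfl
      · intro m h1 h2
        rw [key, if_neg (by omega), add_zero]; exact hl m h1 h2
      · intro m
        rw [key]
        split_ifs with hv
        · subst hv; have := hb1 n; linarith [h.2]
        · rw [add_zero]; exact hu m
    · refine ⟨J + 1, Function.update g n (J + 1), ?_, ?_, ?_, ?_, ?_⟩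
      · intro i hi
        rcases Nat.lt_succ_iff_lt_or_eq.1 hi with hi | rfl
        · rw [upd _ _ hi]; have := hg i hi; simp only [Finset.mem_Icc] at this ⊢; omega
        · simp
      · intro m hmJ
        rw [Finset.mem_Icc] at hmJ
        by_cases hJ : m ≤ J
        · obtain ⟨i, hi, rfl⟩ := hs m (by simp; omega)
          exact ⟨i, by omega, upd _ _ hi⟩
        · exact ⟨n, by omega, by rw [Function.update_self]; omega⟩
      · intro i j hij hj
        rcases Nat.lt_succ_iff_lt_or_eq.1 hj with hj | rfl
        · rw [upd _ _ hj, upd _ _ (by omega)]; exact hm i j hij hj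
        · rcases hij.lt_or_eq with hij | rfl
          · rw [upd _ _ hij, Function.update_self]
            have := (Finset.mem_Icc.1 (hg i hij)).2; omega
          · exact le_rfl
      · intro m h1 h2
        rw [key, if_neg (by omega), add_zero]
        rcases Nat.lt_succ_iff_lt_or_eq.1 h2 with h2 | rfl
        · exact hl m h1 h2
        · by_contra hlt
          exact h ⟨h1, not_le.1 hlt⟩
      · intro m
        rw [key]
        split_ifs with hv
        · have h0 : (∑ i ∈ Finset.range n, if g i = m then b i else 0) = 0 := by
            refine Finset.sum_eq_zero fun i hi => if_neg ?_
            have := (Finset.mem_Icc.1 (hg i (Finset.mem_range.1 hi))).2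
            omega
          rw [h0]; have := hb1 n; linarith
        · rw [add_zero]; exact hu m

/-- `Fin M`-indexed form of `exists_greedy_blocks`. -/
theorem exists_greedy_partition {M : ℕ} (b : Fin M → ℝ) (hb1 : ∀ i, b i ≤ 1) {c : ℝ}
    (hc : 0 ≤ c) : ∃ (J : ℕ) (A : ℕ → Finset (Fin M)),
      IsGroupPartition J A ∧ IsConsecutive J A ∧
      (∀ m, 1 ≤ m → m < J → c ≤ ∑ i ∈ A m, b i) ∧ (∀ m, ∑ i ∈ A m, b i ≤ c + 1) := by
  set b' : ℕ → ℝ := fun i => if h : i < M then b ⟨i, h⟩ else 0 with hb'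
  obtain ⟨J, g, hg, hs, hm, hl, hu⟩ := exists_greedy_blocks b'
    (fun i => by simp only [hb']; split_ifs <;> simp [hb1]) hc M
  have key : ∀ m, ∑ i ∈ Finset.univ.filter (fun i : Fin M => g i = m), b i
      = ∑ i ∈ Finset.range M, if g i = m then b' i else 0 := by
    intro m
    rw [Finset.sum_filter, ← Fin.sum_univ_eq_sum_range (fun i => if g i = m then b' i else 0) M]
    exact Finset.sum_congr rfl fun i _ => by simp [hb']
  refine ⟨J, fun m => Finset.univ.filter (fun i : Fin M => g i = m), ⟨?_, ?_, ?_⟩, ?_, ?_, ?_⟩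
  · intro m hmJ
    obtain ⟨i, hi, h⟩ := hs m hmJ
    exact ⟨⟨i, hi⟩, by simpa using h⟩
  · exact fun i => ⟨g i, hg i i.2, by simp⟩
  · intro m _ n _ hmn
    rw [Finset.disjoint_left]
    intro i hi hi'
    simp only [Finset.mem_filter, Finset.mem_univ, true_and] at hi hi'
    omega
  · intro m _ n _ hmn i hi j hj
    simp only [Finset.mem_filter, Finset.mem_univ, true_and] at hi hj
    by_contra hji
    have := hm j i (by simpa using hji) i.2
    omega
  · intro m h1 h2; rw [key]; exact hl m h1 h2
  · intro m; rw [key]; exact hu m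

/-! ### The cyclic shift -/

theorem injOn_add_mod (J e : ℕ) :
    Set.InjOn (fun k => (k + e) % J) (Finset.range J : Set ℕ) := by
  intro a ha b hb hab
  simp only [Finset.coe_range, Set.mem_Iio] at ha hb
  have h : a ≡ b [MOD J] := Nat.ModEq.add_right_cancel' e hab
  rwa [Nat.ModEq, Nat.mod_eq_of_lt ha, Nat.mod_eq_of_lt hb] at h

/-- Translation modulo `J` permutes the residues; this turns the sum over groups into a sum over
rounds. -/
theorem sum_range_add_mod (J e : ℕ) (F : ℕ → ℝ) :
    ∑ m ∈ Finset.range J, F ((m + e) % J) = ∑ k ∈ Finset.range J, F k := by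
  have himg : (Finset.range J).image (fun k => (k + e) % J) = Finset.range J := by
    refine Finset.eq_of_subset_of_card_le ?_ ?_
    · intro x hx
      obtain ⟨k, hk, rfl⟩ := Finset.mem_image.1 hx
      exact Finset.mem_range.2 (Nat.mod_lt _ (by rw [Finset.mem_range] at hk; omega))
    · rw [Finset.card_image_of_injOn (injOn_add_mod J e)]
  conv_rhs => rw [← himg]
  rw [Finset.sum_image (injOn_add_mod J e)]

theorem shift_mem {J : ℕ} (hJ : 0 < J) (d m : ℕ) : shift J d m ∈ Finset.Icc 1 J := by
  have := Nat.mod_lt (m + d + (J - 1)) hJ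
  simp only [shift, Finset.mem_Icc]; omega

/-- Each group is active in only one round: needed for independence of the rounds and for counting
the exceptional round once. -/
theorem shift_succ_inj {J d a b : ℕ} (ha : a < J) (hb : b < J)
    (h : shift J d (a + 1) = shift J d (b + 1)) : a = b := by
  refine injOn_add_mod J (1 + d + (J - 1)) (by simpa using ha) (by simpa using hb) ?_
  simpa [shift, add_assoc] using h

/-! ### Entropy of a variable with given mean -/

theorem entropy_congr {Ω α : Type*} [MeasurableSpace Ω] {P Q : Measure Ω} {X Y : Ω → α}
    (h : ∀ x, P.real (X ⁻¹' {x}) = Q.real (Y ⁻¹' {x})) : entropy P X = entropy Q Y := by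
  simp only [entropy, h]

theorem entropy_eq_sum {Ω : Type*} [MeasurableSpace Ω] (P : Measure Ω) {X : Ω → ℕ} {N : ℕ}
    (hX : ∀ ω, X ω ≤ N) : entropy P X = ∑ n ∈ Finset.range (N + 1),
      -(P.real (X ⁻¹' {n}) * Real.logb 2 (P.real (X ⁻¹' {n}))) := by
  refine tsum_eq_sum fun n hn => ?_
  have : X ⁻¹' {n} = ∅ := by
    ext ω
    have := hX ω
    simp only [Finset.mem_range] at hn
    simp only [Set.mem_preimage, Set.mem_singleton_iff, Set.mem_empty_iff_false, iff_false]
    omega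
  simp [this]

theorem entropy_const {Ω α : Type*} [MeasurableSpace Ω] (P : Measure Ω) [IsProbabilityMeasure P]
    (c : α) : entropy P (fun _ => c) = 0 := by
  unfold entropy
  rw [← tsum_zero (α := ℝ) (β := α)]
  refine tsum_congr fun x => ?_
  by_cases h : c = x
  · have : (fun _ : Ω => c) ⁻¹' {x} = Set.univ := by ext; simp [h]
    simp [this]
  · have : (fun _ : Ω => c) ⁻¹' {x} = ∅ := by ext; simp [h]
    simp [this]

theorem entropy_const_add {Ω : Type*} [MeasurableSpace Ω] (P : Measure Ω) (X : Ω → ℕ) (u : ℕ) :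
    entropy P (fun ω => u + X ω) = entropy P X := by
  unfold entropy
  rw [← (add_right_injective u).tsum_eq]
  · refine tsum_congr fun n => ?_
    have : (fun ω => u + X ω) ⁻¹' {u + n} = X ⁻¹' {n} := by ext ω; simp
    simp only [this]
  · intro n hn
    by_contra hnr
    have : (fun ω => u + X ω) ⁻¹' {n} = ∅ := by
      ext ω
      simp only [Set.mem_preimage, Set.mem_singleton_iff, Set.mem_empty_iff_false, iff_false]
      exact fun h => hnr ⟨X ω, h⟩
    simp [this] at hn

/-- The entropy inequality `∑ -p log p ≤ ∑ -p log q` with `q` geometric of mean `μ`. -/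
theorem sum_negMulLog_le {N : ℕ} {p : ℕ → ℝ} {μ : ℝ} (hp : ∀ n, 0 ≤ p n)
    (hsum : ∑ n ∈ Finset.range N, p n = 1) (hμ : 0 < μ)
    (hmean : ∑ n ∈ Finset.range N, n * p n ≤ μ) :
    ∑ n ∈ Finset.range N, -(p n * Real.log (p n)) ≤ Real.log (1 + μ) + 1 := by
  -- The geometric law `(1 - r) r ^ n` has mean `r / (1 - r) = μ`.
  set r : ℝ := μ / (1 + μ) with hr
  have hr0 : 0 < r := by positivity
  have hr1 : r < 1 := by rw [hr, div_lt_one (by linarith)]; linarith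
  have h1r : 1 - r = 1 / (1 + μ) := by rw [hr]; field_simp; ring
  have hlogr : -Real.log r ≤ 1 / μ := by
    rw [← Real.log_inv]
    refine (Real.log_le_sub_one_of_pos (by positivity)).trans (le_of_eq ?_)
    rw [hr]; field_simp; ring
  -- This is `log x ≤ x - 1` at `x = (1 - r) r ^ n / p n`, multiplied by `p n`. Upon summation the
  -- last two terms contribute at most `1 - 1 = 0`.
  have hpt : ∀ n : ℕ, -(p n * Real.log (p n)) ≤
      p n * Real.log (1 + μ) + (n * p n) * (1 / μ) + (1 - r) * r ^ n - p n := by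
    intro n
    have hq : 0 < (1 - r) * r ^ n := mul_pos (by linarith) (pow_pos hr0 n)
    rcases (hp n).eq_or_lt with h0 | h0
    · rw [← h0]; simp [hq.le]
    · have h := Real.log_le_sub_one_of_pos (div_pos hq h0)
      rw [Real.log_div hq.ne' h0.ne', Real.log_mul (by linarith) (pow_pos hr0 n).ne', Real.log_pow,
        h1r, one_div, Real.log_inv, ← one_div, ← h1r] at h
      have h2 := mul_le_mul_of_nonneg_left h h0.le
      have h3 : p n * ((1 - r) * r ^ n / p n - 1) = (1 - r) * r ^ n - p n := by field_simp
      have h4 : (n * p n) * (-Real.log r) ≤ (n * p n) * (1 / μ) :=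
        mul_le_mul_of_nonneg_left hlogr (mul_nonneg (Nat.cast_nonneg n) h0.le)
      rw [h3] at h2
      nlinarith
  refine (Finset.sum_le_sum fun n _ => hpt n).trans ?_
  rw [Finset.sum_sub_distrib, Finset.sum_add_distrib, Finset.sum_add_distrib, ← Finset.sum_mul,
    ← Finset.sum_mul, ← Finset.mul_sum, hsum]
  have hg : (1 - r) * ∑ n ∈ Finset.range N, r ^ n ≤ 1 := by
    rw [mul_comm, geom_sum_mul_neg]
    linarith [pow_pos hr0 N]
  have hm : (∑ n ∈ Finset.range N, n * p n) * (1 / μ) ≤ 1 := by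
    rw [mul_one_div, div_le_one hμ]; exact hmean
  linarith

theorem integral_eq_sum_range {Ω : Type*} [MeasurableSpace Ω] (P : Measure Ω)
    [IsFiniteMeasure P] {X : Ω → ℕ} (hX : Measurable X) {N : ℕ} (hN : ∀ ω, X ω ≤ N) :
    ∫ ω, (X ω : ℝ) ∂P = ∑ n ∈ Finset.range (N + 1), n * P.real (X ⁻¹' {n}) := by
  have h : ∀ ω, (X ω : ℝ) = ∑ n ∈ Finset.range (N + 1), (X ⁻¹' {n}).indicator (fun _ => (n : ℝ)) ω := by
    intro ω
    rw [Finset.sum_eq_single (X ω)]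
    · simp
    · intro n _ hn
      simp [Ne.symm hn]
    · intro h
      have := hN ω
      simp at h; omega
  simp_rw [h]
  have hint : ∀ n ∈ Finset.range (N + 1),
      Integrable ((X ⁻¹' {n}).indicator fun _ => (n : ℝ)) P := fun n _ =>
    (integrable_const (n : ℝ)).indicator (hX (measurableSet_singleton n))
  rw [integral_finsetSum _ hint]
  refine Finset.sum_congr rfl fun n _ => ?_
  rw [integral_indicator_const _ (hX (measurableSet_singleton n)), smul_eq_mul, mul_comm]

theorem entropy_le {Ω : Type*} [MeasurableSpace Ω] (P : Measure Ω) [IsProbabilityMeasure P]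
    {X : Ω → ℕ} (hX : Measurable X) {N : ℕ} (hN : ∀ ω, X ω ≤ N) {μ : ℝ} (hμ : 0 < μ)
    (hmean : ∫ ω, (X ω : ℝ) ∂P ≤ μ) :
    entropy P X ≤ Real.logb 2 (1 + μ) + 1 / Real.log 2 := by
  have hlog2 : 0 < Real.log 2 := Real.log_pos (by norm_num)
  rw [integral_eq_sum_range P hX hN] at hmean
  have hsum : ∑ n ∈ Finset.range (N + 1), P.real (X ⁻¹' {n}) = 1 := by
    rw [sum_measureReal_preimage_singleton _ fun n _ => hX (measurableSet_singleton n)]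
    have : X ⁻¹' (Finset.range (N + 1) : Set ℕ) = Set.univ := by
      ext ω; have := hN ω; simp; omega
    rw [this]; simp
  have h := sum_negMulLog_le (fun n => measureReal_nonneg) hsum hμ hmean
  rw [entropy_eq_sum P hN, Real.logb, ← add_div, le_div_iff₀ hlog2, Finset.sum_mul]
  refine le_trans (le_of_eq (Finset.sum_congr rfl fun n _ => ?_)) h
  rw [Real.logb]; field_simp

end GroupBroadcast

namespace GroupBroadcast

/-! ### One round -/

/-- If `T` is independent of `U` and is added to `U` only while `U < θ`, the conditional entropy of
the result given `U` is at most `P(U < θ) H(T)` (in fact equal to it). -/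
theorem condEntropy_add_le {Ω : Type*} [MeasurableSpace Ω] (P : Measure Ω)
    [IsProbabilityMeasure P] {U T V : Ω → ℕ} (hU : Measurable U)
    (hUT : IndepFun U T P) {θ : ℕ} (hV : ∀ ω, V ω = U ω + if U ω < θ then T ω else 0) :
    condEntropy P V U ≤ P.real {ω | U ω < θ} * entropy P T := by
  have hms : ∀ u, MeasurableSet (U ⁻¹' {u}) := fun u => hU (measurableSet_singleton u)
  have hterm : ∀ u, P.real (U ⁻¹' {u}) * entropy (cond P (U ⁻¹' {u})) V
      = if u < θ then P.real (U ⁻¹' {u}) * entropy P T else 0 := by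
    intro u
    -- On a null atom conditioning gives no probability measure, but the weight is zero.
    by_cases h0 : P (U ⁻¹' {u}) = 0
    · simp [measureReal_def, h0]
    have := cond_isProbabilityMeasure h0
    split_ifs with hu
    · congr 1
      rw [← entropy_const_add P T u]
      refine entropy_congr fun x => ?_
      have hset : U ⁻¹' {u} ∩ V ⁻¹' {x} = U ⁻¹' {u} ∩ (fun ω => u + T ω) ⁻¹' {x} := by
        ext ω
        simp only [Set.mem_inter_iff, Set.mem_preimage, Set.mem_singleton_iff]
        refine and_congr_right fun h => ?_
        rw [hV, h, if_pos hu]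
      have hpre : (fun ω => u + T ω) ⁻¹' {x} = T ⁻¹' {n | u + n = x} := rfl
      rw [measureReal_def, measureReal_def, cond_apply (hms u), hset, hpre,
        hUT.measure_inter_preimage_eq_mul _ _ (measurableSet_singleton u)
          (MeasurableSet.of_discrete), ← mul_assoc,
        ENNReal.inv_mul_cancel h0 (measure_ne_top _ _), one_mul]
    · rw [entropy_congr (Q := cond P (U ⁻¹' {u})) (Y := fun _ => u), entropy_const, mul_zero]
      intro x
      rw [measureReal_def, measureReal_def, cond_apply (hms u), cond_apply (hms u)]
      congr 3
      ext ω
      simp only [Set.mem_inter_iff, Set.mem_preimage, Set.mem_singleton_iff]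
      refine and_congr_right fun h => ?_
      rw [hV, h, if_neg hu, add_zero]
  unfold condEntropy
  simp_rw [hterm]
  rw [tsum_eq_sum (s := Finset.range θ) fun u hu => if_neg (by simpa using hu),
    Finset.sum_congr rfl fun u hu => if_pos (Finset.mem_range.1 hu), ← Finset.sum_mul,
    sum_measureReal_preimage_singleton _ fun u _ => hms u]
  refine le_of_eq ?_
  congr 2
  ext ω; simp

/-! ### Sums of independent indicators -/

section groupSum

variable {Ω : Type*} {M q : ℕ}

/-- The number of `i ∈ F` with `S i = ℓ`. -/
def groupSum (F : Finset (Fin M)) (ℓ : Fin q) (S : Fin M → Ω → Fin q) (ω : Ω) : ℕ :=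
  ∑ i ∈ F, if S i ω = ℓ then 1 else 0

theorem groupSum_le (F : Finset (Fin M)) (ℓ : Fin q) (S : Fin M → Ω → Fin q) (ω : Ω) :
    groupSum F ℓ S ω ≤ M := by
  calc groupSum F ℓ S ω ≤ ∑ i ∈ F, 1 := Finset.sum_le_sum fun i _ => by split_ifs <;> simp
    _ ≤ M := by simpa using F.card_le_univ

theorem measurable_groupSum [MeasurableSpace Ω] (F : Finset (Fin M)) (ℓ : Fin q) {S : Fin M → Ω → Fin q}
    (hS : ∀ i, Measurable (S i)) : Measurable (groupSum F ℓ S) :=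
  Finset.measurable_fun_sum _ fun i _ =>
    (measurable_of_finite fun s : Fin q => if s = ℓ then 1 else 0).comp (hS i)

theorem integral_indicator_eq [MeasurableSpace Ω] (P : Measure Ω) (ℓ : Fin q) {X : Ω → Fin q} (hX : Measurable X) :
    ∫ ω, (if X ω = ℓ then (1 : ℝ) else 0) ∂P = P.real (X ⁻¹' {ℓ}) := by
  rw [← integral_indicator_one (hX (measurableSet_singleton ℓ))]
  exact integral_congr_ae (Filter.Eventually.of_forall fun ω => by
    by_cases h : X ω = ℓ <;> simp [h])

theorem integral_groupSum [MeasurableSpace Ω] (P : Measure Ω) [IsProbabilityMeasure P] (F : Finset (Fin M)) (ℓ : Fin q)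
    {S : Fin M → Ω → Fin q} (hS : ∀ i, Measurable (S i)) :
    ∫ ω, (groupSum F ℓ S ω : ℝ) ∂P = ∑ i ∈ F, P.real (S i ⁻¹' {ℓ}) := by
  have h : ∀ ω, (groupSum F ℓ S ω : ℝ) = ∑ i ∈ F, if S i ω = ℓ then (1 : ℝ) else 0 := by
    intro ω; simp [groupSum]
  simp_rw [h]
  rw [integral_finsetSum]
  · exact Finset.sum_congr rfl fun i _ => integral_indicator_eq P ℓ (hS i)
  · intro i _
    refine Integrable.of_bound (C := 1) ?_ ?_
    · exact ((measurable_of_finite fun s : Fin q => if s = ℓ then (1 : ℝ) else 0).comp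
        (hS i)).aestronglyMeasurable
    · exact Filter.Eventually.of_forall fun ω => by split_ifs <;> simp

/-- Since `exp (-1) ≤ 1/2`, `exp (-x) ≤ 1 - x/2` for `x ∈ {0, 1}`; integrate and use `1 - y ≤ exp
(-y)`. -/
theorem mgf_indicator_le [MeasurableSpace Ω] (P : Measure Ω) [IsProbabilityMeasure P] (ℓ : Fin q) {X : Ω → Fin q}
    (hX : Measurable X) :
    mgf (fun ω => if X ω = ℓ then (1 : ℝ) else 0) P (-1)
      ≤ Real.exp (-(P.real (X ⁻¹' {ℓ}) / 2)) := by
  have hint : Integrable (fun ω => if X ω = ℓ then (1 : ℝ) else 0) P := by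
    refine Integrable.of_bound (C := 1) ?_ ?_
    · exact ((measurable_of_finite fun s : Fin q => if s = ℓ then (1 : ℝ) else 0).comp
        hX).aestronglyMeasurable
    · exact Filter.Eventually.of_forall fun ω => by split_ifs <;> simp
  have hexp : Real.exp (-1) ≤ 1 / 2 := by
    rw [Real.exp_neg, ← one_div]
    exact one_div_le_one_div_of_le (by norm_num) (by linarith [Real.add_one_le_exp 1])
  have h : ∀ ω, Real.exp (-1 * (if X ω = ℓ then (1 : ℝ) else 0))
      ≤ 1 - (if X ω = ℓ then (1 : ℝ) else 0) * (1 / 2) := by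
    intro ω
    split_ifs
    · norm_num; linarith
    · simp
  unfold mgf
  refine (integral_mono_of_nonneg (Filter.Eventually.of_forall fun ω => (Real.exp_pos _).le)
    ((integrable_const 1).sub (hint.mul_const _)) (Filter.Eventually.of_forall h)).trans ?_
  simp only [Pi.sub_apply]
  rw [integral_sub (integrable_const 1) (hint.mul_const _), integral_mul_const,
    integral_indicator_eq P ℓ hX]
  have := Real.add_one_le_exp (-(P.real (X ⁻¹' {ℓ}) / 2))
  simp
  linarith

/-- Chernoff's bound: a group whose mean is at least `2 θ + 2` stays below `θ` with probability at
most `1 / 3`. -/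
theorem measure_groupSum_lt_le [MeasurableSpace Ω] (P : Measure Ω) [IsProbabilityMeasure P] (F : Finset (Fin M))
    (ℓ : Fin q) {S : Fin M → Ω → Fin q} (hS : ∀ i, Measurable (S i)) (hind : iIndepFun S P)
    {θ : ℕ} (hF : 2 * (θ : ℝ) + 2 ≤ ∑ i ∈ F, P.real (S i ⁻¹' {ℓ})) :
    P.real {ω | groupSum F ℓ S ω < θ} ≤ 1 / 3 := by
  set X : Fin M → Ω → ℝ := fun i ω => if S i ω = ℓ then (1 : ℝ) else 0 with hX
  have hmeas : ∀ i, Measurable (X i) := fun i =>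
    (measurable_of_finite fun s : Fin q => if s = ℓ then (1 : ℝ) else 0).comp (hS i)
  have hindX : iIndepFun X P :=
    hind.comp (fun _ s => if s = ℓ then (1 : ℝ) else 0) fun _ => measurable_of_finite _
  have hcast : ∀ ω, (∑ i ∈ F, X i) ω = (groupSum F ℓ S ω : ℝ) := by
    intro ω; simp [groupSum, hX, Finset.sum_apply]
  have hint : Integrable (fun ω => Real.exp (-1 * (∑ i ∈ F, X i) ω)) P := by
    refine Integrable.of_bound (C := 1) ?_ ?_
    · simp only [Finset.sum_apply]
      exact ((Finset.measurable_sum F fun i _ => hmeas i).const_mul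
        (-1)).exp.aestronglyMeasurable
    · refine Filter.Eventually.of_forall fun ω => ?_
      rw [hcast, Real.norm_eq_abs, abs_of_pos (Real.exp_pos _), Real.exp_le_one_iff]
      linarith [Nat.cast_nonneg (α := ℝ) (groupSum F ℓ S ω)]
  have hch := measure_le_le_exp_mul_mgf ((θ : ℝ) - 1) (t := -1) (by norm_num) hint
  rw [hindX.mgf_sum hmeas] at hch
  have hset : {ω | groupSum F ℓ S ω < θ} = {ω | (∑ i ∈ F, X i) ω ≤ (θ : ℝ) - 1} := by
    ext ω
    rw [Set.mem_ofPred_eq, Set.mem_ofPred_eq, hcast, le_sub_iff_add_le]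
    exact_mod_cast Nat.lt_iff_add_one_le
  have hprod : ∏ i ∈ F, mgf (X i) P (-1)
      ≤ Real.exp (-((∑ i ∈ F, P.real (S i ⁻¹' {ℓ})) / 2)) := by
    rw [Finset.sum_div, ← Finset.sum_neg_distrib, Real.exp_sum]
    exact Finset.prod_le_prod (fun i _ => mgf_nonneg) fun i _ => mgf_indicator_le P ℓ (hS i)
  rw [hset]
  refine hch.trans ((mul_le_mul_of_nonneg_left hprod (Real.exp_pos _).le).trans ?_)
  rw [← Real.exp_add]
  -- The exponent is at most `(θ - 1) - (2θ + 2)/2 = -2`, which is what fixes the group size `2θ +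
  -- 2`; then `exp 2 ≥ 3`.
  refine (Real.exp_le_exp.2 (show _ ≤ (-2 : ℝ) by linarith)).trans ?_
  rw [Real.exp_neg, ← one_div]
  exact one_div_le_one_div_of_le (by norm_num) (by linarith [Real.add_one_le_exp 2])

/-! ### Dependence of the descriptions on the sensors -/

/-- The description after `k` rounds depends only on the sensors active in these rounds. -/
theorem descr_congr {Ω' : Type*} (θ J d : ℕ) (A : ℕ → Finset (Fin M)) (ℓ : Fin q)
    {S : Fin M → Ω → Fin q} {S' : Fin M → Ω' → Fin q} {ω : Ω} {ω' : Ω'} (k : ℕ)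
    (h : ∀ j < k, ∀ i ∈ A (shift J (J - d) (j + 1)), S i ω = S' i ω') :
    descr θ J d A ℓ S k ω = descr θ J d A ℓ S' k ω' := by
  induction k with
  | zero => rfl
  | succ k ih =>
    simp only [descr]
    rw [ih fun j hj => h j (by omega)]
    congr 1
    exact Finset.sum_congr rfl fun i hi => by rw [h k (by omega) i hi]

theorem descr_succ (θ J d : ℕ) (A : ℕ → Finset (Fin M)) (ℓ : Fin q) (S : Fin M → Ω → Fin q)
    (k : ℕ) (ω : Ω) : descr θ J d A ℓ S (k + 1) ω = descr θ J d A ℓ S k ω +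
      if descr θ J d A ℓ S k ω < θ then groupSum (A (shift J (J - d) (k + 1))) ℓ S ω else 0 := by
  simp only [descr, groupSum]
  split_ifs with h <;> simp [h]

theorem measurable_descr [MeasurableSpace Ω] (θ J d : ℕ) (A : ℕ → Finset (Fin M)) (ℓ : Fin q)
    {S : Fin M → Ω → Fin q} (hS : ∀ i, Measurable (S i)) (k : ℕ) :
    Measurable (descr θ J d A ℓ S k) := by
  have h : descr θ J d A ℓ S k =
      (fun f : Fin M → Fin q => descr θ J d A ℓ (fun i f => f i) k f) ∘ fun ω i => S i ω := by
    ext ω; exact descr_congr θ J d A ℓ k fun _ _ _ _ => rfl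
  rw [h]
  exact (measurable_of_finite _).comp (measurable_pi_lambda _ hS)

theorem indepFun_descr_groupSum [MeasurableSpace Ω] (P : Measure Ω) [IsProbabilityMeasure P] {θ J d k : ℕ}
    {A : ℕ → Finset (Fin M)} (hA : IsGroupPartition J A) (hk : k < J) (ℓ : Fin q)
    {S : Fin M → Ω → Fin q} (hS : ∀ i, Measurable (S i)) (hind : iIndepFun S P) :
    IndepFun (descr θ J d A ℓ S k) (groupSum (A (shift J (J - d) (k + 1))) ℓ S) P := by
  classical
  set G := A (shift J (J - d) (k + 1)) with hG
  set F := (Finset.range k).biUnion fun j => A (shift J (J - d) (j + 1)) with hF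
  have hdisj : Disjoint F G := by
    rw [hF, Finset.disjoint_biUnion_left]
    intro j hj
    rw [Finset.mem_range] at hj
    refine hA.disjoint _ (shift_mem (by omega) _ _) _ (shift_mem (by omega) _ _) fun h => ?_
    have := shift_succ_inj (by omega) hk h
    omega
  have hI := hind.indepFun_finset F G hdisj hS
  -- The default `ℓ` outside `F` is immaterial: the first `k` rounds read only sensors in `F`.
  let φ : (F → Fin q) → ℕ := fun f =>
    descr θ J d A ℓ (fun i (f : F → Fin q) => if h : i ∈ F then f ⟨i, h⟩ else ℓ) k f
  let ψ : (G → Fin q) → ℕ := fun f => ∑ i : G, if f i = ℓ then 1 else 0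
  have h1 : descr θ J d A ℓ S k = φ ∘ fun ω (i : F) => S i ω := by
    ext ω
    refine descr_congr θ J d A ℓ k fun j hj i hi => ?_
    have : i ∈ F := Finset.mem_biUnion.2 ⟨j, Finset.mem_range.2 hj, hi⟩
    simp [this]
  have h2 : groupSum G ℓ S = ψ ∘ fun ω (i : G) => S i ω := by
    ext ω
    exact (Finset.sum_coe_sort G fun i => if S i ω = ℓ then 1 else 0).symm
  rw [h1, h2]
  exact hI.comp (measurable_of_finite _) (measurable_of_finite _)

end groupSum

/-! ### The number of active rounds -/

/-- A bound for the sum of a nonincreasing sequence that shrinks by a factor `3` at all steps but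
those marked by `c k = 1`. -/
theorem sum_le_of_contract {a c : ℕ → ℝ} {n : ℕ} (ha1 : ∀ k, a k ≤ 1)
    (hstep : ∀ k < n, (c k = 0 ∧ a (k + 1) ≤ 1 / 3 * a k) ∨ (c k = 1 ∧ a (k + 1) ≤ a k)) :
    ∑ k ∈ Finset.range n, a k + 3 / 2 * a n ≤ 3 / 2 + ∑ k ∈ Finset.range n, c k := by
  induction n with
  | zero => simp; linarith [ha1 0]
  | succ n ih =>
    have h := ih fun k hk => hstep k (by omega)
    rw [Finset.sum_range_succ, Finset.sum_range_succ]
    -- The term `3/2 * a n` is a potential: a contracting step releases at least `a n`, and at a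
    -- marked step `a n ≤ 1` is paid by `c n = 1`.
    rcases hstep n (by omega) with ⟨hc, hs⟩ | ⟨hc, hs⟩
    · linarith
    · linarith [ha1 n]

theorem sum_condEntropy_le {Ω : Type*} [MeasurableSpace Ω] {M q : ℕ} (P : Measure Ω)
    [IsProbabilityMeasure P] {θ J d : ℕ} {A : ℕ → Finset (Fin M)} (hA : IsGroupPartition J A)
    (ℓ : Fin q) {S : Fin M → Ω → Fin q} (hS : ∀ i, Measurable (S i)) (hind : iIndepFun S P)
    (hlow : ∀ m, 1 ≤ m → m < J → 2 * (θ : ℝ) + 2 ≤ ∑ i ∈ A m, P.real (S i ⁻¹' {ℓ}))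
    (hup : ∀ m, ∑ i ∈ A m, P.real (S i ⁻¹' {ℓ}) ≤ 2 * (θ : ℝ) + 2 + 1) :
    ∑ k ∈ Finset.range J, condEntropy P (descr θ J d A ℓ S (k + 1)) (descr θ J d A ℓ S k)
      < 5 / 2 * Real.logb 2 (1 + (θ : ℝ)) + 12 := by
  set a : ℕ → ℝ := fun k => P.real {ω | descr θ J d A ℓ S k ω < θ} with ha
  set g : ℕ → ℕ := fun k => shift J (J - d) (k + 1) with hg
  set H : ℝ := Real.logb 2 (1 + (2 * (θ : ℝ) + 2 + 1)) + 1 / Real.log 2 with hH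
  have hθ : (0 : ℝ) ≤ θ := Nat.cast_nonneg θ
  have hent : ∀ k < J, condEntropy P (descr θ J d A ℓ S (k + 1)) (descr θ J d A ℓ S k)
      ≤ a k * H := by
    intro k hk
    refine (condEntropy_add_le P (measurable_descr θ J d A ℓ hS k) (indepFun_descr_groupSum P hA hk ℓ hS hind)
      (descr_succ θ J d A ℓ S k)).trans (mul_le_mul_of_nonneg_left ?_ measureReal_nonneg)
    refine entropy_le P (measurable_groupSum _ ℓ hS) (groupSum_le _ ℓ S) (by linarith) ?_
    rw [integral_groupSum P _ ℓ hS]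
    exact hup _
  have hmul : ∀ k < J, a (k + 1) ≤ P.real {ω | groupSum (A (g k)) ℓ S ω < θ} * a k := by
    intro k hk
    have hI := (indepFun_descr_groupSum (θ := θ) (d := d) P hA hk ℓ hS
      hind).measure_inter_preimage_eq_mul (Set.Iio θ) (Set.Iio θ) measurableSet_Iio
      measurableSet_Iio
    have hsub : {ω | descr θ J d A ℓ S (k + 1) ω < θ} ⊆
        descr θ J d A ℓ S k ⁻¹' Set.Iio θ ∩ groupSum (A (g k)) ℓ S ⁻¹' Set.Iio θ := by
      intro ω hω
      rw [Set.mem_ofPred_eq, descr_succ] at hω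
      have h1 : descr θ J d A ℓ S k ω < θ := by omega
      rw [if_pos h1] at hω
      exact ⟨h1, by simp only [Set.mem_preimage, Set.mem_Iio, hg]; omega⟩
    refine (measureReal_mono hsub).trans (le_of_eq ?_)
    rw [measureReal_def, hI, ENNReal.toReal_mul, mul_comm]
    rfl
  have hsum := sum_le_of_contract (a := a) (c := fun k => if g k = J then 1 else 0) (n := J)
    (fun _ => measureReal_le_one) fun k hk => by
      have hgk := Finset.mem_Icc.1 (shift_mem (by omega : 0 < J) (J - d) (k + 1))
      by_cases h : g k = J
      · refine Or.inr ⟨if_pos h, (hmul k hk).trans ?_⟩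
        exact mul_le_of_le_one_left measureReal_nonneg measureReal_le_one
      · refine Or.inl ⟨if_neg h, (hmul k hk).trans ?_⟩
        refine mul_le_mul_of_nonneg_right ?_ measureReal_nonneg
        exact measure_groupSum_lt_le P _ ℓ hS hind
          (hlow _ hgk.1 (lt_of_le_of_ne hgk.2 h))
  have hbad : ∑ k ∈ Finset.range J, (if g k = J then (1 : ℝ) else 0) ≤ 1 := by
    rw [Finset.sum_boole]
    have : (Finset.filter (fun k => g k = J) (Finset.range J)).card ≤ 1 := by
      rw [Finset.card_le_one]
      intro x hx y hy
      simp only [Finset.mem_filter, Finset.mem_range] at hx hy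
      exact shift_succ_inj hx.1 hy.1 (hx.2.trans hy.2.symm)
    exact_mod_cast this
  have hlog2 : 0.6931471803 < Real.log 2 := Real.log_two_gt_d9
  -- `2θ + 4 ≤ 4 (1 + θ)` costs 2 bits, and `1 / log 2 ≤ 3/2`.
  have hHle : H ≤ Real.logb 2 (1 + (θ : ℝ)) + 7 / 2 := by
    have h1 : Real.logb 2 (1 + (2 * (θ : ℝ) + 2 + 1)) ≤ Real.logb 2 (1 + (θ : ℝ)) + 2 := by
      have h4 : Real.logb 2 4 = 2 := by
        rw [show (4 : ℝ) = 2 ^ 2 by norm_num, Real.logb_pow]; simp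
      calc _ ≤ Real.logb 2 ((1 + (θ : ℝ)) * 4) := ?_
        _ = _ := by rw [Real.logb_mul (by linarith) (by norm_num), h4]
      exact Real.logb_le_logb_of_le (by norm_num) (by linarith) (by linarith)
    have h2 : 1 / Real.log 2 ≤ 3 / 2 := by
      rw [div_le_iff₀ (by linarith)]; linarith
    linarith
  have hH0 : 0 ≤ Real.logb 2 (1 + (θ : ℝ)) := Real.logb_nonneg (by norm_num) (by linarith)
  have hasum : ∑ k ∈ Finset.range J, a k ≤ 5 / 2 := by
    have : 0 ≤ a J := measureReal_nonneg
    linarith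
  calc _ ≤ ∑ k ∈ Finset.range J, a k * H :=
        Finset.sum_le_sum fun k hk => hent k (Finset.mem_range.1 hk)
    _ ≤ ∑ k ∈ Finset.range J, a k * (Real.logb 2 (1 + (θ : ℝ)) + 7 / 2) :=
        Finset.sum_le_sum fun k _ => mul_le_mul_of_nonneg_left hHle measureReal_nonneg
    _ = (∑ k ∈ Finset.range J, a k) * (Real.logb 2 (1 + (θ : ℝ)) + 7 / 2) := by
        rw [Finset.sum_mul]
    _ ≤ 5 / 2 * (Real.logb 2 (1 + (θ : ℝ)) + 7 / 2) :=
        mul_le_mul_of_nonneg_right hasum (by linarith)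
    -- `5/2 * 7/2 = 35/4 < 12`.
    _ < _ := by linarith

end GroupBroadcast

theorem mainTheorem3 (M q : ℕ) (θ : Fin q → ℕ) (p : Fin M → PMF (Fin q)) (ℓ : Fin q) :
    ∃ (J : ℕ) (A : ℕ → Finset (Fin M)),
      GroupBroadcast.IsGroupPartition J A ∧ GroupBroadcast.IsConsecutive J A ∧
      ∀ (Ω : Type*) [MeasurableSpace Ω] (P : Measure Ω) [IsProbabilityMeasure P]
        (S : Fin M → Ω → Fin q),
        (∀ i, Measurable (S i)) → (∀ i, P.map (S i) = (p i).toMeasure) → iIndepFun S P →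
        ∀ d ∈ Finset.range J,
          ∑ m ∈ Finset.range J,
            GroupBroadcast.condEntropy P
              (GroupBroadcast.descr (θ ℓ) J d A ℓ S (GroupBroadcast.shift J d m))
              (GroupBroadcast.descr (θ ℓ) J d A ℓ S (GroupBroadcast.shift J d m - 1))
          < 5 / 2 * Real.logb 2 (1 + (θ ℓ : ℝ)) + 12 := by
  obtain ⟨J, A, hA, hcons, hlow, hup⟩ := GroupBroadcast.exists_greedy_partition
    (fun i => (p i).toMeasure.real {ℓ}) (fun i => measureReal_le_one)
    (c := 2 * (θ ℓ : ℝ) + 2) (by positivity)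
  refine ⟨J, A, hA, hcons, fun Ω _ P _ S hS hlaw hind d _ => ?_⟩
  -- The group means depend only on the laws `p i`, so one partition serves every probability space
  -- and every shift.
  have hb : ∀ i, (p i).toMeasure.real {ℓ} = P.real (S i ⁻¹' {ℓ}) := fun i => by
    rw [← hlaw i, map_measureReal_apply (hS i) (measurableSet_singleton ℓ)]
  simp only [hb] at hlow hup
  refine lt_of_eq_of_lt ?_
    (GroupBroadcast.sum_condEntropy_le (d := d) P hA ℓ hS hind hlow hup)
  -- Round `m(d)` is `k + 1` with `k = (m + d + (J - 1)) % J`; the index `m = 0` stands for group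
  -- `J`.
  rw [← GroupBroadcast.sum_range_add_mod J (d + (J - 1)) fun k => GroupBroadcast.condEntropy P
    (GroupBroadcast.descr (θ ℓ) J d A ℓ S (k + 1)) (GroupBroadcast.descr (θ ℓ) J d A ℓ S k)]
  refine Finset.sum_congr rfl fun m _ => ?_
  simp only [GroupBroadcast.shift, Nat.add_sub_cancel, add_assoc]
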